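/- **Notation.** Fix $N$ and write $I$ for the $N\times N$ identity matrix. Matrices are complex $N\times N$, $A^*$ is the conjugate transpose, $F^*(z):=(F(\bar z))^*$ for a matrix function $F$ of $z\in\mathbb C$, and $F^{-*}(z):=\big(F(\bar z)^{-1}\big)^*$. **Weight and polynomials.** Let $W$ be a smooth, (Hermitian) positive definite matrix function on $\mathbb R$ such that all entries of $W$ and $W'$ have finite moments of all orders. For matrix polynomials put $(P,Q)_W=\int_{\mathbb R}P(x)W(x)Q(x)^*\,dx$. Let $\widehat P_n(x)=x^nI+\sum_{j<n}a_{n,j}x^j$ $(n\ge 0)$ be the monic orthogonal matrix polynomials, i.e. $(\widehat P_n,Q)_W=0$ for every matrix polynomial $Q$ of degree $<n$; put $\widehat P_{-1}=0$, $a_{n,n}=I$ and $a_{n,j}=0$ for $j<0$. Let $\kappa_n$ be matrices such that the polynomials $\kappa_n\widehat P_n$ are orthonormal, $(\kappa_n\widehat P_n,\kappa_k\widehat P_k)_W=\delta_{n,k}I$, and put $$\gamma_n=\kappa_n^*\kappa_n,\qquad \alpha_n=a_{n,n-1}-a_{n+1,n},\qquad \beta_n=\gamma_n^{-1}\gamma_{n-1}\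 (n\ge1),\quad \beta_0=0,$$ $$b_{n,k}=\int_{\mathbb R} x^k\widehat P_n(x)W(x)\,dx\ (k\ge n),\qquad b_{n,k}=0\ (k<n).$$ **The coefficients $\mathcal A_n,\mathcal B_n$.** For a matrix polynomial $G(z)=\sum_{j=0}^m M_jz^j$ of degree $m$ let $$\Delta_{j,n}(z)=\sum_{k=0}^{j}\Big(\sum_{l=0}^{k}a_{n,n-l}z^{k-l}\Big)M_{m-j+k},$$ $$\mathcal A_n(z;G)=-\gamma_n\sum_{j=0}^{m-1}\Big(b_{n,n+m-j-1}\Delta_{j,n}^*(z)+\Delta_{j,n}(z)b_{n,n+m-j-1}^*\Big)\quad(n\ge0),$$ $$\mathcal B_n(z;G)=-\sum_{j=0}^{m}\Big(\Delta_{j,n}(z)b_{n-1,n+m-j-1}^*+b_{n,n+m-j-2}\Delta_{j,n-1}^*(z)\Big)\gamma_{n-1}\quad(n\ge1),\qquad \mathcal B_0(z;G)=-G(z)$$ (for $G=0$ take $m=0$). **Assumptions.** There are an entire matrix function $T$ and a matrix polynomial $G$ such that $W(x)=T(x)T(x)^*$ for $x\in\mathbb R$ and $T'(z)=G(z)T(z)$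 in a neighbourhood of the origin. There are moreover an entire matrix function $S$, non-singular on $\mathbb C$ and unitary on $\mathbb R$, and a matrix polynomial $H$, such that $H(z)=T(z)S'(z)S^*(z)T(z)^{-1}$ for all $z\in\mathbb C$. **Conclusion.** For every $n\ge0$ and all $z\in\mathbb C$ the following hold. 1. $\alpha_n,\beta_n$ are the coefficients of the three-term recurrence: $z\widehat P_n(z)=\widehat P_{n+1}(z)+\alpha_n\widehat P_n(z)+\beta_n\widehat P_{n-1}(z)$. 2. First order lowering and raising relations: $$\widehat P_n'(z)+\widehat P_n(z)G(z)=-\mathcal B_n(z;G)\widehat P_n(z)+\mathcal A_n^*(z;G)\beta_n\widehat P_{n-1}(z),$$ $$\widehat P_n'(z)+\widehat P_n(z)G(z)=\big(\mathcal A_n^*(z;G)(zI-\alpha_n)-\mathcal B_n(z;G)\big)\widehat P_n(z)-\mathcal A_n^*(z;G)\widehat P_{n+1}(z).$$ 3. Lowering and raising relations of order zero: $$\widehat P_n(z)H(z)=-\mathcal B_n(z;H)\widehat P_n(z)+\mathcal A_n^*(z;H)\beta_n\widehat P_{n-1}(z),$$ $$\widehat P_n(z)H(z)=\big(\mathcal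 A_n^*(z;H)(zI-\alpha_n)-\mathcal B_n(z;H)\big)\widehat P_n(z)-\mathcal A_n^*(z;H)\widehat P_{n+1}(z).$$ 4. If $\mathcal A_n(w;G)$ is invertible for all $w\in\mathbb C$, then $$\widehat P_n(z)H(z)+\mathcal B_n(z;H)\widehat P_n(z)-\mathcal A_n^*(z;H)\mathcal A_n^{-*}(z;G)\big(\widehat P_n'(z)+\widehat P_n(z)G(z)+\mathcal B_n(z;G)\widehat P_n(z)\big)=0.$$ -/

import Mathlib

open Polynomial MeasureTheory
open scoped ContDiff Topology ComplexConjugate ComplexOrder Matrix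

noncomputable section

namespace MOPRL

/-- Complex `N × N` matrices. -/
abbrev Mat (N : ℕ) := Matrix (Fin N) (Fin N) ℂ

/-- The value `∑ zʲ Mⱼ` of the matrix polynomial `∑ Mⱼ zʲ` at the scalar `z`. -/
def mEval {N : ℕ} (P : (Mat N)[X]) (z : ℂ) : Mat N := P.eval (Matrix.scalar (Fin N) z)

/-- `F*(z) = (F(z̄))*` for a matrix-valued function of a complex variable. -/
def mStar {N : ℕ} (F : ℂ → Mat N) (z : ℂ) : Mat N := (F (conj z))ᴴ

/-- Entrywise complex derivative of a matrix-valued function. -/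
def mDeriv {N : ℕ} (F : ℂ → Mat N) (z : ℂ) : Mat N :=
  Matrix.of fun i j => deriv (fun w => F w i j) z

/-- Entrywise integral over the real line of a matrix-valued function. -/
def mIntegral {N : ℕ} (F : ℝ → Mat N) : Mat N :=
  Matrix.of fun i j => ∫ x : ℝ, F x i j

/-- A smooth positive definite weight on the whole real line, such that `W` and `W'` have finite
moments of all orders. -/
structure IsWeight {N : ℕ} (W : ℝ → Mat N) : Prop where
  smooth : ∀ i j, ContDiff ℝ ∞ (fun x => W x i j)
  posDef : ∀ x, (W x).PosDef
  moments : ∀ (n : ℕ) (i j), Integrable (fun x : ℝ => (x : ℂ) ^ n * W x i j)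
  moments_deriv : ∀ (n : ℕ) (i j),
    Integrable (fun x : ℝ => (x : ℂ) ^ n * deriv (fun t => W t i j) x)

/-- The matrix-valued inner product `(P, Q)_W = ∫ P(x) W(x) Q(x)* dx`. -/
def mInner {N : ℕ} (W : ℝ → Mat N) (P Q : (Mat N)[X]) : Mat N :=
  mIntegral fun x => mEval P x * W x * (mEval Q x)ᴴ

/-- `P n` is, for each `n`, the monic orthogonal matrix polynomial of degree `n`. -/
structure IsMonicMOPRL {N : ℕ} (W : ℝ → Mat N) (P : ℕ → (Mat N)[X]) : Prop where
  natDegree_le : ∀ n, (P n).natDegree ≤ n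
  coeff_self : ∀ n, (P n).coeff n = 1
  orthogonal : ∀ (n : ℕ) (Q : (Mat N)[X]), Q.degree < n → mInner W (P n) Q = 0

/-- The polynomials `κₙ Pₙ` are orthonormal. -/
def IsNormalization {N : ℕ} (W : ℝ → Mat N) (P : ℕ → (Mat N)[X]) (κ : ℕ → Mat N) : Prop :=
  ∀ n k, mInner W (C (κ n) * P n) (C (κ k) * P k) = if n = k then 1 else 0

/-- `γₙ = κₙ* κₙ`. -/
def gam {N : ℕ} (κ : ℕ → Mat N) (n : ℕ) : Mat N := (κ n)ᴴ * κ n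

/-- `a_{n,k}`, the coefficient of `xᵏ` in `Pₙ`; it is `0` for `k < 0`. -/
def aCoeff {N : ℕ} (P : ℕ → (Mat N)[X]) (n : ℕ) (k : ℤ) : Mat N :=
  if k < 0 then 0 else (P n).coeff k.toNat

/-- `b_{n,k} = ∫ xᵏ Pₙ(x) W(x) dx` for `k ≥ n`; it is `0` for `k < n` (where, for `0 ≤ k < n`, the
integral vanishes by orthogonality). -/
def bCoeff {N : ℕ} (W : ℝ → Mat N) (P : ℕ → (Mat N)[X]) (n : ℕ) (k : ℤ) : Mat N :=
  if k < n then 0 else mIntegral fun x => (x : ℂ) ^ k.toNat • (mEval (P n) x * W x)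

/-- `αₙ = a_{n,n-1} - a_{n+1,n}`. -/
def alp {N : ℕ} (P : ℕ → (Mat N)[X]) (n : ℕ) : Mat N :=
  aCoeff P n ((n : ℤ) - 1) - aCoeff P (n + 1) n

/-- `βₙ = γₙ⁻¹ γₙ₋₁` for `n ≥ 1` and `β₀ = 0`. -/
def bet {N : ℕ} (κ : ℕ → Mat N) : ℕ → Mat N
  | 0 => 0
  | n + 1 => (gam κ (n + 1))⁻¹ * gam κ n

/-- `Pₙ₋₁`, with `P₋₁ = 0`. -/
def prev {N : ℕ} (P : ℕ → (Mat N)[X]) : ℕ → (Mat N)[X]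
  | 0 => 0
  | n + 1 => P n

/-- `P_{n,k}(z) = zᵏ I + a_{n,n-1} zᵏ⁻¹ + ⋯ + a_{n,n-k}`. -/
def truncP {N : ℕ} (P : ℕ → (Mat N)[X]) (n k : ℕ) (z : ℂ) : Mat N :=
  ∑ l ∈ Finset.range (k + 1), z ^ (k - l) • aCoeff P n ((n : ℤ) - l)

/-- `Δ_{j,n}(z) = ∑_{k=0}^{j} P_{n,k}(z) M_{m-j+k}`, where `G = ∑_{i=0}^{m} Mᵢ zⁱ` has degree `m`
(used for `j ≤ m` only). -/
def Del {N : ℕ} (P : ℕ → (Mat N)[X]) (G : (Mat N)[X]) (j n : ℕ) (z : ℂ) : Mat N :=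
  ∑ k ∈ Finset.range (j + 1), truncP P n k z * G.coeff (G.natDegree - j + k)

/-- The polynomial coefficient `𝒜ₙ(z; G)`, with `m = deg G`. -/
def ladderA {N : ℕ} (W : ℝ → Mat N) (P : ℕ → (Mat N)[X]) (κ : ℕ → Mat N) (G : (Mat N)[X])
    (n : ℕ) (z : ℂ) : Mat N :=
  -(gam κ n * ∑ j ∈ Finset.range G.natDegree,
    (bCoeff W P n ((n : ℤ) + G.natDegree - j - 1) * mStar (Del P G j n) z
      + Del P G j n z * (bCoeff W P n ((n : ℤ) + G.natDegree - j - 1))ᴴ))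

/-- The polynomial coefficient `ℬₙ(z; G)`, with `m = deg G`. For `n = 0`, where `P₋₁ = 0`, the
`(1,1)` block of the coefficient matrix of the differential system is `G`, so that `ℬ₀ = -G`
(the convention `γ₋₁ b₋₁,₋₁ = I`, all other quantities with a first index `-1` being zero). -/
def ladderB {N : ℕ} (W : ℝ → Mat N) (P : ℕ → (Mat N)[X]) (κ : ℕ → Mat N) (G : (Mat N)[X]) :
    ℕ → ℂ → Mat N
  | 0, z => -mEval G z
  | n + 1, z =>
    -((∑ j ∈ Finset.range (G.natDegree + 1),
      (Del P G j (n + 1) z * (bCoeff W P n (((n + 1 : ℕ) : ℤ) + G.natDegree - j - 1))ᴴ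
        + bCoeff W P (n + 1) (((n + 1 : ℕ) : ℤ) + G.natDegree - j - 2)
          * mStar (Del P G j n) z)) * gam κ n)

/-- `W = T T*` on the real line, with `T` entire and `T' = G T` in a neighbourhood of the origin for
the matrix polynomial `G`. -/
structure IsFactorization {N : ℕ} (W : ℝ → Mat N) (T : ℂ → Mat N) (G : (Mat N)[X]) : Prop where
  entire : ∀ i j, Differentiable ℂ (fun z => T z i j)
  factor : ∀ x : ℝ, W x = T x * (T x)ᴴ
  ode : ∀ᶠ z in 𝓝 (0 : ℂ), mDeriv T z = mEval G z * T z

/-- `S` is entire, non-singular on the plane, unitary on the real line, and the matrix polynomial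
`H` is `T S' S* T⁻¹`. -/
structure IsUnitaryChange {N : ℕ} (T S : ℂ → Mat N) (H : (Mat N)[X]) : Prop where
  entire : ∀ i j, Differentiable ℂ (fun z => S z i j)
  nonsingular : ∀ z, IsUnit (S z)
  unitary : ∀ x : ℝ, S x ∈ Matrix.unitaryGroup (Fin N) ℂ
  eq_H : ∀ z, mEval H z = T z * mDeriv S z * mStar S z * (T z)⁻¹

end MOPRL

end

open MOPRL

namespace MOPRL

/-! ### Evaluation of matrix polynomials at scalars -/

/-! Both families of relations come from one operator `L : Q ↦ ε Q' + Q G` that is skew-symmetric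
for `⟨·,·⟩_W`. For `ε = 1` this is integration by parts, since `W = T T*` and `T' = G T` give `W' =
G W + W G*`. For `ε = 0`, with `H` in place of `G`, it holds pointwise: on the real line `H W + W H*
= T (S S*)' T* = 0`.

To evaluate `F = L Pₙ₊₁` at `z`, divide: `F = F(z) + (X - z) D`. Let `K` be the Christoffel-Darboux
kernel of degree at most `n` at `z`. Since `⟨1, K⟩ = 1`, moving `X - z` to the other side gives `⟨D,
(X - z̄) K⟩ = ⟨F, K⟩ - F(z)`. Skew-symmetry and orthogonality also give `⟨Pₙ₊₁, L((X - z̄) K)/(X -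
z̄)⟩ = -⟨F, K⟩`. Adding the two eliminates `⟨F, K⟩`, and the Christoffel-Darboux formula
(`mul_kernelCD`) writes `(X - z̄) K` through `Pₙ₊₁` and `Pₙ`. This is the lowering relation, with
inner products as coefficients (`mEval_ladderOp`).

It remains to recognise these inner products as `𝒜ₙ` and `ℬₙ`. The `Δ_{j,n}(z)` are the top
coefficients of the quotient of `L Pₙ` by `X - z` (`Del_eq_coeff`), and the lower coefficients meet
vanishing moments. The raising relations follow by the three-term recurrence, and the last relation
by eliminating `βₙ Pₙ₋₁` between the two lowering relations. -/

theorem mEval_add {N : ℕ} (P Q : (Mat N)[X]) (z : ℂ) :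
    mEval (P + Q) z = mEval P z + mEval Q z := eval_add

theorem mEval_sub {N : ℕ} (P Q : (Mat N)[X]) (z : ℂ) :
    mEval (P - Q) z = mEval P z - mEval Q z := eval_sub _ _ _

theorem mEval_C {N : ℕ} (A : Mat N) (z : ℂ) : mEval (C A) z = A := eval_C

theorem mEval_one {N : ℕ} (z : ℂ) : mEval (1 : (Mat N)[X]) z = 1 := eval_one

/-- Scalar matrices are central; this makes evaluation multiplicative although the coefficients do
not commute. -/
theorem commute_scalar {N : ℕ} (A : Mat N) (z : ℂ) : Commute A (Matrix.scalar (Fin N) z) :=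
  (Matrix.scalar_commute z (fun _ => Commute.all _ _) A).symm

theorem mEval_mul {N : ℕ} (P Q : (Mat N)[X]) (z : ℂ) :
    mEval (P * Q) z = mEval P z * mEval Q z :=
  eval₂_mul_noncomm _ _ fun _ => commute_scalar _ _

theorem scalar_mul_eq_smul {N : ℕ} (z : ℂ) (A : Mat N) :
    Matrix.scalar (Fin N) z * A = z • A := by
  rw [Matrix.scalar_apply, ← Matrix.smul_eq_diagonal_mul]

theorem mul_scalar_eq_smul {N : ℕ} (z : ℂ) (A : Mat N) :
    A * Matrix.scalar (Fin N) z = z • A := by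
  rw [(commute_scalar A z).eq, scalar_mul_eq_smul]

theorem mEval_X_mul {N : ℕ} (P : (Mat N)[X]) (z : ℂ) : mEval (X * P) z = z • mEval P z := by
  rw [mEval_mul, ← scalar_mul_eq_smul]
  simp [mEval]

theorem mEval_monomial {N : ℕ} (n : ℕ) (A : Mat N) (z : ℂ) :
    mEval (monomial n A) z = z ^ n • A := by
  rw [mEval, eval_monomial, ← map_pow, mul_scalar_eq_smul]

theorem conjTranspose_scalar {N : ℕ} (z : ℂ) :
    (Matrix.scalar (Fin N) z)ᴴ = Matrix.scalar (Fin N) (conj z) := by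
  rw [Matrix.scalar_apply, Matrix.scalar_apply, Matrix.diagonal_conjTranspose]
  rfl

/-! ### Entrywise integrals of matrix functions -/

/-- Entrywise integrability of a matrix-valued function. -/
def MIntegrable {N : ℕ} (F : ℝ → Mat N) : Prop := ∀ i j, Integrable fun x => F x i j

theorem MIntegrable.add {N : ℕ} {F F' : ℝ → Mat N} (h : MIntegrable F) (h' : MIntegrable F') :
    MIntegrable fun x => F x + F' x := fun i j => (h i j).add (h' i j)

theorem MIntegrable.const_mul {N : ℕ} {F : ℝ → Mat N} (h : MIntegrable F) (A : Mat N) :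
    MIntegrable fun x => A * F x := fun i j => by
  simp only [Matrix.mul_apply]
  exact integrable_finsetSum _ fun k _ => (h k j).const_mul _

theorem MIntegrable.mul_const {N : ℕ} {F : ℝ → Mat N} (h : MIntegrable F) (A : Mat N) :
    MIntegrable fun x => F x * A := fun i j => by
  simp only [Matrix.mul_apply]
  exact integrable_finsetSum _ fun k _ => (h i k).mul_const _

theorem mIntegral_add {N : ℕ} {F F' : ℝ → Mat N} (h : MIntegrable F) (h' : MIntegrable F') :
    mIntegral (fun x => F x + F' x) = mIntegral F + mIntegral F' := by
  ext i j
  exact integral_add (h i j) (h' i j)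

theorem mIntegral_const_mul {N : ℕ} {F : ℝ → Mat N} (h : MIntegrable F) (A : Mat N) :
    mIntegral (fun x => A * F x) = A * mIntegral F := by
  ext i j
  simp only [mIntegral, Matrix.mul_apply, Matrix.of_apply]
  rw [integral_finsetSum _ fun k _ => (h k j).const_mul _]
  simp only [integral_const_mul]

theorem mIntegral_conjTranspose {N : ℕ} (F : ℝ → Mat N) :
    mIntegral (fun x => (F x)ᴴ) = (mIntegral F)ᴴ := by
  ext i j
  exact integral_conj

theorem IsWeight.mIntegrable {N : ℕ} {W : ℝ → Mat N} (hW : IsWeight W) (P Q : (Mat N)[X]) :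
    MIntegrable fun x => mEval P x * W x * (mEval Q x)ᴴ := by
  induction P using Polynomial.induction_on' with
  | add P P' h h' =>
    simpa only [mEval_add, add_mul] using h.add h'
  | monomial m A =>
    induction Q using Polynomial.induction_on' with
    | add Q Q' h h' =>
      simpa only [mEval_add, Matrix.conjTranspose_add, mul_add] using h.add h'
    | monomial k B =>
      have h : MIntegrable fun x : ℝ => (x : ℂ) ^ (m + k) • W x :=
        fun i j => hW.moments (m + k) i j
      refine cast (congrArg MIntegrable (funext fun x => ?_)) ((h.const_mul A).mul_const Bᴴ)
      simp only [mEval_monomial, Matrix.conjTranspose_smul, star_pow, Complex.star_def,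
        Complex.conj_ofReal, Matrix.smul_mul, Matrix.mul_smul, smul_smul, pow_add]
      rw [mul_comm]

/-! ### The matrix-valued inner product -/

theorem mInner_add_left {N : ℕ} {W : ℝ → Mat N} (hW : IsWeight W) (P P' Q : (Mat N)[X]) :
    mInner W (P + P') Q = mInner W P Q + mInner W P' Q := by
  rw [mInner, mInner, mInner, ← mIntegral_add (hW.mIntegrable _ _) (hW.mIntegrable _ _)]
  simp only [mEval_add, add_mul]

theorem mInner_C_mul_left {N : ℕ} {W : ℝ → Mat N} (hW : IsWeight W) (A : Mat N)
    (P Q : (Mat N)[X]) : mInner W (C A * P) Q = A * mInner W P Q := by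
  rw [mInner, mInner, ← mIntegral_const_mul (hW.mIntegrable _ _)]
  simp only [mEval_mul, mEval_C, mul_assoc]

theorem mInner_conjTranspose {N : ℕ} {W : ℝ → Mat N} (hW : IsWeight W) (P Q : (Mat N)[X]) :
    (mInner W P Q)ᴴ = mInner W Q P := by
  rw [mInner, mInner, ← mIntegral_conjTranspose]
  refine congrArg mIntegral (funext fun x => ?_)
  rw [Matrix.conjTranspose_mul, Matrix.conjTranspose_mul, Matrix.conjTranspose_conjTranspose,
    (hW.posDef x).isHermitian.eq, mul_assoc]

theorem mInner_X_mul_left {N : ℕ} {W : ℝ → Mat N} (P Q : (Mat N)[X]) :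
    mInner W (X * P) Q = mInner W P (X * Q) := by
  refine congrArg mIntegral (funext fun x => ?_)
  simp only [mEval_X_mul, Matrix.conjTranspose_smul, Complex.star_def, Complex.conj_ofReal,
    Matrix.smul_mul, Matrix.mul_smul]

theorem mInner_add_right {N : ℕ} {W : ℝ → Mat N} (hW : IsWeight W) (P Q Q' : (Mat N)[X]) :
    mInner W P (Q + Q') = mInner W P Q + mInner W P Q' := by
  rw [← mInner_conjTranspose hW, mInner_add_left hW, Matrix.conjTranspose_add,
    mInner_conjTranspose hW, mInner_conjTranspose hW]

theorem mInner_C_mul_right {N : ℕ} {W : ℝ → Mat N} (hW : IsWeight W) (A : Mat N)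
    (P Q : (Mat N)[X]) : mInner W P (C A * Q) = mInner W P Q * Aᴴ := by
  rw [← mInner_conjTranspose hW, mInner_C_mul_left hW, Matrix.conjTranspose_mul,
    mInner_conjTranspose hW]

theorem mInner_neg_left {N : ℕ} {W : ℝ → Mat N} (hW : IsWeight W) (P Q : (Mat N)[X]) :
    mInner W (-P) Q = -mInner W P Q := by
  rw [← neg_one_mul P, ← C_1, ← C_neg, mInner_C_mul_left hW, neg_one_mul]

theorem mInner_neg_right {N : ℕ} {W : ℝ → Mat N} (hW : IsWeight W) (P Q : (Mat N)[X]) :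
    mInner W P (-Q) = -mInner W P Q := by
  rw [← neg_one_mul Q, ← C_1, ← C_neg, mInner_C_mul_right hW, Matrix.conjTranspose_neg,
    Matrix.conjTranspose_one, mul_neg_one]

theorem mInner_sub_left {N : ℕ} {W : ℝ → Mat N} (hW : IsWeight W) (P P' Q : (Mat N)[X]) :
    mInner W (P - P') Q = mInner W P Q - mInner W P' Q := by
  rw [sub_eq_add_neg, mInner_add_left hW, mInner_neg_left hW, sub_eq_add_neg]

theorem mInner_sub_right {N : ℕ} {W : ℝ → Mat N} (hW : IsWeight W) (P Q Q' : (Mat N)[X]) :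
    mInner W P (Q - Q') = mInner W P Q - mInner W P Q' := by
  rw [sub_eq_add_neg, mInner_add_right hW, mInner_neg_right hW, sub_eq_add_neg]

theorem mInner_zero_left {N : ℕ} {W : ℝ → Mat N} (hW : IsWeight W) (Q : (Mat N)[X]) :
    mInner W 0 Q = 0 := by
  simpa using mInner_C_mul_left hW 0 0 Q

theorem mInner_zero_right {N : ℕ} {W : ℝ → Mat N} (hW : IsWeight W) (P : (Mat N)[X]) :
    mInner W P 0 = 0 := by
  simpa using mInner_C_mul_right hW 0 P 0

theorem mInner_sum_right {N : ℕ} {W : ℝ → Mat N} (hW : IsWeight W) {ι : Type*} (s : Finset ι)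
    (P : (Mat N)[X]) (Q : ι → (Mat N)[X]) :
    mInner W P (∑ i ∈ s, Q i) = ∑ i ∈ s, mInner W P (Q i) := by
  classical
  induction s using Finset.induction_on with
  | empty => simpa using mInner_zero_right hW P
  | insert a s ha ih => rw [Finset.sum_insert ha, Finset.sum_insert ha, mInner_add_right hW, ih]

theorem mInner_X_pow {N : ℕ} {W : ℝ → Mat N} (P : (Mat N)[X]) (r : ℕ) :
    mInner W P (X ^ r) = mIntegral fun x => (x : ℂ) ^ r • (mEval P x * W x) := by
  refine congrArg mIntegral (funext fun x => ?_)
  rw [← monomial_one_right_eq_X_pow, mEval_monomial, Matrix.conjTranspose_smul,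
    Matrix.conjTranspose_one, Matrix.mul_smul, mul_one, star_pow, Complex.star_def,
    Complex.conj_ofReal]

/-! ### Entrywise derivatives of matrix functions of a real variable -/

/-- Entrywise derivative of a matrix-valued function of a real variable. -/
def MHasDerivAt {N : ℕ} (F : ℝ → Mat N) (F' : Mat N) (x : ℝ) : Prop :=
  ∀ i j, HasDerivAt (fun t => F t i j) (F' i j) x

theorem MHasDerivAt.add {N : ℕ} {F K : ℝ → Mat N} {F' K' : Mat N} {x : ℝ}
    (hF : MHasDerivAt F F' x) (hK : MHasDerivAt K K' x) :
    MHasDerivAt (fun t => F t + K t) (F' + K') x := fun i j => (hF i j).add (hK i j)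

theorem MHasDerivAt.mul {N : ℕ} {F K : ℝ → Mat N} {F' K' : Mat N} {x : ℝ}
    (hF : MHasDerivAt F F' x) (hK : MHasDerivAt K K' x) :
    MHasDerivAt (fun t => F t * K t) (F' * K x + F x * K') x := fun i j => by
  simp only [Matrix.mul_apply, Matrix.add_apply, ← Finset.sum_add_distrib]
  exact HasDerivAt.fun_sum fun k _ => (hF i k).mul (hK k j)

theorem MHasDerivAt.conjTranspose {N : ℕ} {F : ℝ → Mat N} {F' : Mat N} {x : ℝ}
    (hF : MHasDerivAt F F' x) : MHasDerivAt (fun t => (F t)ᴴ) F'ᴴ x :=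
  fun i j => (hF j i).star

theorem mHasDerivAt_of_differentiable {N : ℕ} {F : ℂ → Mat N}
    (hF : ∀ i j, Differentiable ℂ fun z => F z i j) (x : ℝ) :
    MHasDerivAt (fun t : ℝ => F t) (mDeriv F x) x :=
  fun i j => (hF i j x).hasDerivAt.comp_ofReal

theorem mHasDerivAt_mEval {N : ℕ} (P : (Mat N)[X]) (x : ℝ) :
    MHasDerivAt (fun t : ℝ => mEval P t) (mEval (derivative P) x) x := by
  induction P using Polynomial.induction_on' with
  | add P Q h h' => simpa only [mEval_add, derivative_add] using h.add h'
  | monomial n A =>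
    intro i j
    rw [derivative_monomial]
    simp only [mEval_monomial, Matrix.smul_apply, smul_eq_mul]
    have := ((hasDerivAt_pow n (x : ℂ)).comp_ofReal).mul_const (A i j)
    refine this.congr_deriv ?_
    rw [← nsmul_eq_mul', Matrix.smul_apply, nsmul_eq_mul]
    ring

theorem differentiable_mEval {N : ℕ} (P : (Mat N)[X]) (i j : Fin N) :
    Differentiable ℂ fun z => mEval P z i j := by
  induction P using Polynomial.induction_on' with
  | add P Q h h' =>
    simp only [mEval_add, Matrix.add_apply]
    exact h.fun_add h'
  | monomial n A =>
    simp only [mEval_monomial, Matrix.smul_apply, smul_eq_mul]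
    fun_prop

/-- The differential equation of the factor `T` holds on the whole plane. -/
theorem IsFactorization.mDeriv_eq {N : ℕ} {W : ℝ → Mat N} {T : ℂ → Mat N} {G : (Mat N)[X]}
    (hT : IsFactorization W T G) (z : ℂ) : mDeriv T z = mEval G z * T z := by
  ext i j
  have h1 : Differentiable ℂ fun z => mDeriv T z i j :=
    (hT.entire i j).contDiff.differentiable_deriv_two
  have h2 : Differentiable ℂ fun z => (mEval G z * T z) i j := by
    simp only [Matrix.mul_apply]
    exact Differentiable.fun_sum fun k _ => (differentiable_mEval G i k).mul (hT.entire k j)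
  -- Identity theorem: both sides are entire and agree near the origin.
  refine congrFun (AnalyticOnNhd.eq_of_eventuallyEq (𝕜 := ℂ) (z₀ := 0)
    (fun z _ => h1.analyticAt z) (fun z _ => h2.analyticAt z) ?_) z
  filter_upwards [hT.ode] with w hw
  rw [hw]

theorem IsFactorization.mHasDerivAt {N : ℕ} {W : ℝ → Mat N} {T : ℂ → Mat N} {G : (Mat N)[X]}
    (hT : IsFactorization W T G) (x : ℝ) :
    MHasDerivAt W (mEval G x * W x + W x * (mEval G x)ᴴ) x := by
  have hd := mHasDerivAt_of_differentiable hT.entire x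
  have h := hd.mul hd.conjTranspose
  rw [hT.mDeriv_eq] at h
  have hWT : W = fun t : ℝ => T t * (T t)ᴴ := funext hT.factor
  rw [hWT]
  simpa only [Matrix.conjTranspose_mul, mul_assoc] using h

/-- The operator `P ↦ P' + P G` is skew-symmetric with respect to `W`. -/
theorem IsFactorization.mInner_skew {N : ℕ} {W : ℝ → Mat N} (hW : IsWeight W) {T : ℂ → Mat N}
    {G : (Mat N)[X]} (hT : IsFactorization W T G) (P Q : (Mat N)[X]) :
    mInner W (derivative P + P * G) Q = -mInner W P (derivative Q + Q * G) := by
  rw [eq_neg_iff_add_eq_zero, mInner, mInner,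
    ← mIntegral_add (hW.mIntegrable _ _) (hW.mIntegrable _ _)]
  ext i j
  -- The integrand is the derivative of `P W Q*`. Both are integrable on the line, so the integral
  -- vanishes without a separate study of boundary terms.
  refine integral_eq_zero_of_hasDerivAt_of_integrable (f := fun x => _) (fun x => ?_)
    (((hW.mIntegrable _ _).add (hW.mIntegrable _ _)) i j) (hW.mIntegrable P Q i j)
  have h := ((mHasDerivAt_mEval P x).mul (hT.mHasDerivAt x)).mul
    (mHasDerivAt_mEval Q x).conjTranspose
  refine (h i j).congr_deriv (congrFun (congrFun ?_ i) j)
  simp only [mEval_add, mEval_mul, Matrix.conjTranspose_add, Matrix.conjTranspose_mul]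
  noncomm_ring

/-- The operator `P ↦ P H` is skew-symmetric with respect to `W`. -/
theorem IsUnitaryChange.mInner_skew {N : ℕ} {W : ℝ → Mat N} (hW : IsWeight W) {T : ℂ → Mat N}
    {G : (Mat N)[X]} (hT : IsFactorization W T G) {S : ℂ → Mat N} {H : (Mat N)[X]}
    (hS : IsUnitaryChange T S H) (P Q : (Mat N)[X]) :
    mInner W (P * H) Q = -mInner W P (Q * H) := by
  -- With `W = T T*` the left side is `T (S' S* + S S'*) T*`, and the bracket is the derivative of
  -- `S S* = 1`. Cancelling `T⁻¹` in `H` is allowed because `det W > 0` on the real line.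
  have hskew (x : ℝ) : mEval H x * W x + W x * (mEval H x)ᴴ = 0 := by
    have hdet : IsUnit (T x).det := by
      rw [isUnit_iff_ne_zero]
      intro h0
      have := (hW.posDef x).det_pos
      rw [hT.factor, Matrix.det_mul, h0, zero_mul] at this
      exact this.ne' rfl
    have hd := mHasDerivAt_of_differentiable hS.entire x
    have hSS : mDeriv S x * (S x)ᴴ + S x * (mDeriv S x)ᴴ = 0 := by
      ext i j
      refine ((hd.mul hd.conjTranspose) i j).unique ?_
      have h1 : (fun t : ℝ => (S t * (S t)ᴴ) i j) = fun _ => (1 : Mat N) i j := by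
        funext t
        rw [← Matrix.star_eq_conjTranspose, (Matrix.mem_unitaryGroup_iff).1 (hS.unitary t)]
      rw [h1]
      exact hasDerivAt_const _ _
    have hHT : mEval H x * T x = T x * mDeriv S x * (S x)ᴴ := by
      rw [hS.eq_H, Matrix.nonsing_inv_mul_cancel_right _ _ hdet, mStar, Complex.conj_ofReal]
    rw [hT.factor, ← mul_assoc, hHT, mul_assoc (T x) (T x)ᴴ, ← Matrix.conjTranspose_mul, hHT]
    simp only [Matrix.conjTranspose_mul, Matrix.conjTranspose_conjTranspose, mul_assoc]
    rw [← mul_add, ← mul_assoc, ← mul_assoc, ← add_mul, hSS, zero_mul, mul_zero]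
  rw [eq_neg_iff_add_eq_zero, mInner, mInner,
    ← mIntegral_add (hW.mIntegrable _ _) (hW.mIntegrable _ _)]
  have h0 (x : ℝ) : mEval (P * H) x * W x * (mEval Q x)ᴴ
      + mEval P x * W x * (mEval (Q * H) x)ᴴ = 0 := by
    rw [mEval_mul, mEval_mul, Matrix.conjTranspose_mul, mul_assoc _ (mEval H x), mul_assoc _ (W x),
      ← mul_assoc (W x), mul_assoc, ← mul_add, ← add_mul, hskew, zero_mul, mul_zero]
  simp only [h0]
  ext i j
  simp [mIntegral]

/-! ### Monic orthogonal matrix polynomials -/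

section Orthogonal

variable {N : ℕ} {W : ℝ → Mat N} {P : ℕ → (Mat N)[X]} {κ : ℕ → Mat N}

theorem gam_conjTranspose (κ : ℕ → Mat N) (n : ℕ) : (gam κ n)ᴴ = gam κ n := by
  simp [gam]

/-- Orthonormality reads `κ ⟨P, P⟩ κ* = 1`. For square matrices a one-sided inverse is two-sided, so
`κ` can be moved to the right end. -/
theorem mInner_self_mul_gam (hW : IsWeight W) (hκ : IsNormalization W P κ) (n : ℕ) :
    mInner W (P n) (P n) * gam κ n = 1 := by
  have h := hκ n n
  rw [if_pos rfl, mInner_C_mul_left hW, mInner_C_mul_right hW] at h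
  have h' := mul_eq_one_comm.1 h
  rwa [mul_assoc] at h'

theorem gam_mul_mInner_self (hW : IsWeight W) (hκ : IsNormalization W P κ) (n : ℕ) :
    gam κ n * mInner W (P n) (P n) = 1 :=
  mul_eq_one_comm.1 (mInner_self_mul_gam hW hκ n)

theorem isUnit_det_gam (hW : IsWeight W) (hκ : IsNormalization W P κ) (n : ℕ) :
    IsUnit (gam κ n).det := by
  rw [← Matrix.isUnit_iff_isUnit_det]
  exact IsUnit.of_mul_eq_one _ (gam_mul_mInner_self hW hκ n)

theorem gam_mul_bet_succ (hW : IsWeight W) (hκ : IsNormalization W P κ) (n : ℕ) :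
    gam κ (n + 1) * bet κ (n + 1) = gam κ n := by
  rw [bet, Matrix.mul_nonsing_inv_cancel_left _ _ (isUnit_det_gam hW hκ _)]

theorem gam_mul_bet_conjTranspose (hW : IsWeight W) (hκ : IsNormalization W P κ) (n : ℕ) :
    (bet κ n)ᴴ * gam κ n = gam κ n * bet κ n := by
  cases n with
  | zero => simp [bet]
  | succ n =>
    nth_rewrite 1 [← gam_conjTranspose κ (n + 1)]
    rw [← Matrix.conjTranspose_mul, gam_mul_bet_succ hW hκ, gam_conjTranspose]

theorem IsMonicMOPRL.coeff_eq_zero (hP : IsMonicMOPRL W P) {n m : ℕ} (h : n < m) :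
    (P n).coeff m = 0 :=
  coeff_eq_zero_of_natDegree_lt ((hP.natDegree_le n).trans_lt h)

theorem IsMonicMOPRL.degree_lt (hP : IsMonicMOPRL W P) {n m : ℕ} (h : n < m) :
    (P n).degree < m :=
  (degree_lt_iff_coeff_zero _ _).2 fun _ hk => hP.coeff_eq_zero (h.trans_le hk)

theorem IsMonicMOPRL.orthogonal_left (hW : IsWeight W) (hP : IsMonicMOPRL W P) (n : ℕ)
    (Q : (Mat N)[X]) (hQ : Q.degree < n) : mInner W Q (P n) = 0 := by
  rw [← mInner_conjTranspose hW, hP.orthogonal n Q hQ, Matrix.conjTranspose_zero]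

/-- If `c` is the leading coefficient of a nonzero `R` of degree `d`, then `R - c P_d` has lower
degree and is orthogonal to `P_d`. Hence `c ⟨P_d, P_d⟩ = 0`, and `c = 0` because the norm is
invertible. -/
theorem IsMonicMOPRL.eq_zero_of_mInner (hW : IsWeight W) (hP : IsMonicMOPRL W P)
    (hκ : IsNormalization W P κ) {n : ℕ} {R : (Mat N)[X]} (hR : R.degree < n)
    (h : ∀ k < n, mInner W R (P k) = 0) : R = 0 := by
  by_contra h0
  have hd : R.natDegree < n := (natDegree_lt_iff_degree_lt h0).2 hR
  have hlow : (R - C R.leadingCoeff * P R.natDegree).degree < R.natDegree := by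
    rw [degree_lt_iff_coeff_zero]
    intro m hm
    rw [coeff_sub, coeff_C_mul]
    rcases hm.eq_or_lt with rfl | hm
    · rw [hP.coeff_self, mul_one, coeff_natDegree, sub_self]
    · rw [hP.coeff_eq_zero hm, coeff_eq_zero_of_natDegree_lt hm, mul_zero, sub_zero]
  have h1 := hP.orthogonal_left hW _ _ hlow
  rw [mInner_sub_left hW, h _ hd, mInner_C_mul_left hW, zero_sub, neg_eq_zero] at h1
  have h2 := congrArg (· * gam κ R.natDegree) h1
  simp only [mul_assoc, mInner_self_mul_gam hW hκ, mul_one, zero_mul] at h2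
  exact h0 (leadingCoeff_eq_zero.1 h2)

/-- The three-term recurrence relation. -/
theorem IsMonicMOPRL.X_mul (hW : IsWeight W) (hP : IsMonicMOPRL W P)
    (hκ : IsNormalization W P κ) (n : ℕ) :
    X * P n = P (n + 1) + C (alp P n) * P n + C (bet κ n) * prev P n := by
  rw [← sub_eq_zero]
  refine hP.eq_zero_of_mInner hW hκ (n := n) ?_ fun k hk => ?_
  · rw [degree_lt_iff_coeff_zero]
    intro m hm
    rcases n with _ | n
    · rcases m with _ | _ | m
      · simp [alp, aCoeff, bet, hP.coeff_self]
      · simp [bet, hP.coeff_self, hP.coeff_eq_zero]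
      · simp [bet, hP.coeff_eq_zero]
    · rcases m with _ | m
      · omega
      · have hprev : (prev P (n + 1)).coeff (m + 1) = 0 := hP.coeff_eq_zero (by omega)
        simp only [coeff_sub, coeff_add, coeff_X_mul, coeff_C_mul, hprev, mul_zero, add_zero]
        obtain rfl | rfl | hm : m = n ∨ m = n + 1 ∨ n + 1 < m := by omega
        · rw [hP.coeff_self, mul_one, alp, aCoeff, aCoeff, if_neg (by omega), if_neg (by omega)]
          have h1 : (((m + 1 : ℕ) : ℤ) - 1).toNat = m := by omega
          have h2 : ((m + 1 : ℕ) : ℤ).toNat = m + 1 := by omega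
          rw [h1, h2]
          abel
        · rw [hP.coeff_self, hP.coeff_self, hP.coeff_eq_zero (by omega)]
          simp
        · rw [hP.coeff_eq_zero hm, hP.coeff_eq_zero (by omega), hP.coeff_eq_zero (by omega)]
          simp
  · rcases n with _ | n
    · omega
    · have hXk : (X * P k - P (k + 1)).degree < ((k + 1 : ℕ) : WithBot ℕ) := by
        rw [degree_lt_iff_coeff_zero]
        rintro (_ | m) hm
        · omega
        · rw [coeff_sub, coeff_X_mul]
          rcases hm.eq_or_lt with h | h
          · obtain rfl : k = m := by omega
            rw [hP.coeff_self, hP.coeff_self, sub_self]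
          · rw [hP.coeff_eq_zero (by omega), hP.coeff_eq_zero h, sub_self]
      have h1 : mInner W (X * P (n + 1)) (P k) = mInner W (P (n + 1)) (P (k + 1)) := by
        rw [mInner_X_mul_left, ← sub_eq_zero, ← mInner_sub_right hW]
        exact hP.orthogonal _ _ (hXk.trans_le (by exact_mod_cast hk))
      rw [mInner_sub_left hW, mInner_add_left hW, mInner_add_left hW, mInner_C_mul_left hW,
        mInner_C_mul_left hW, h1, hP.orthogonal (n + 2) _ (hP.degree_lt (by omega)),
        hP.orthogonal (n + 1) (P k) (hP.degree_lt hk), mul_zero, zero_add, zero_add, prev]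
      rcases (Nat.lt_succ_iff.1 hk).eq_or_lt with rfl | hk
      · rw [bet, mul_assoc, gam_mul_mInner_self hW hκ, mul_one, sub_eq_zero]
        exact (Matrix.inv_eq_right_inv (gam_mul_mInner_self hW hκ _)).symm
      · rw [hP.orthogonal (n + 1) _ (hP.degree_lt (by omega)),
          hP.orthogonal n _ (hP.degree_lt hk), mul_zero, sub_zero]

/-- Multiplication by `X` is symmetric, so `⟨X Pₙ, Pₙ⟩ = αₙ ⟨Pₙ, Pₙ⟩` is Hermitian; conjugating by
`γₙ`, the inverse of the norm, gives the claim. -/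
theorem IsMonicMOPRL.alp_conjTranspose_mul_gam (hW : IsWeight W) (hP : IsMonicMOPRL W P)
    (hκ : IsNormalization W P κ) (n : ℕ) :
    (alp P n)ᴴ * gam κ n = gam κ n * alp P n := by
  have h : mInner W (X * P n) (P n) = alp P n * mInner W (P n) (P n) := by
    have hprev : mInner W (prev P n) (P n) = 0 := by
      cases n with
      | zero => exact mInner_zero_left hW _
      | succ n => exact hP.orthogonal_left hW _ _ (hP.degree_lt (by omega))
    rw [hP.X_mul hW hκ, mInner_add_left hW, mInner_add_left hW, mInner_C_mul_left hW,
      mInner_C_mul_left hW, hprev, hP.orthogonal _ _ (hP.degree_lt (by omega)), mul_zero, add_zero,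
      zero_add]
  have hsymm : mInner W (P n) (P n) * (alp P n)ᴴ = alp P n * mInner W (P n) (P n) := by
    rw [← h]
    rw [mInner_X_mul_left]
    rw [← mInner_conjTranspose hW (X * P n), h, Matrix.conjTranspose_mul,
      mInner_conjTranspose hW]
  calc (alp P n)ᴴ * gam κ n
      = gam κ n * (mInner W (P n) (P n) * (alp P n)ᴴ) * gam κ n := by
        rw [← mul_assoc, gam_mul_mInner_self hW hκ, one_mul]
    _ = gam κ n * alp P n := by
        rw [hsymm, mul_assoc, mul_assoc, mInner_self_mul_gam hW hκ, mul_one]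

theorem IsMonicMOPRL.smul_mEval (hW : IsWeight W) (hP : IsMonicMOPRL W P)
    (hκ : IsNormalization W P κ) (n : ℕ) (z : ℂ) :
    z • mEval (P n) z =
      mEval (P (n + 1)) z + alp P n * mEval (P n) z + bet κ n * mEval (prev P n) z := by
  rw [← mEval_X_mul, hP.X_mul hW hκ]
  simp only [mEval_add, mEval_mul, mEval_C]

/-- The Christoffel-Darboux kernel, as a polynomial in its first variable. -/
noncomputable def kernelCD (P : ℕ → (Mat N)[X]) (κ : ℕ → Mat N) (n : ℕ) (z : ℂ) : (Mat N)[X] :=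
  ∑ k ∈ Finset.range n, C ((mEval (P k) z)ᴴ * gam κ k) * P k

theorem IsMonicMOPRL.degree_kernelCD_lt (hP : IsMonicMOPRL W P) (n : ℕ) (z : ℂ) :
    (kernelCD P κ n z).degree < n := by
  rw [degree_lt_iff_coeff_zero]
  intro m hm
  rw [kernelCD, finsetSum_coeff]
  refine Finset.sum_eq_zero fun k hk => ?_
  rw [coeff_C_mul, hP.coeff_eq_zero (by have := Finset.mem_range.1 hk; omega), mul_zero]

/-- The reproducing property on constants: every term with `k > 0` is orthogonal to `1`. -/
theorem IsMonicMOPRL.mInner_one_kernelCD (hW : IsWeight W) (hP : IsMonicMOPRL W P)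
    (hκ : IsNormalization W P κ) (n : ℕ) (z : ℂ) :
    mInner W 1 (kernelCD P κ (n + 1) z) = 1 := by
  have h0 : P 0 = 1 := by
    rw [eq_C_of_natDegree_le_zero (hP.natDegree_le 0), hP.coeff_self, C_1]
  rw [kernelCD, mInner_sum_right hW, Finset.sum_range_succ']
  simp only [mInner_C_mul_right hW]
  rw [Finset.sum_eq_zero, zero_add]
  · rw [h0, mEval_one, Matrix.conjTranspose_one, one_mul, gam_conjTranspose]
    simpa only [h0] using mInner_self_mul_gam hW hκ 0
  · intro k _
    rw [← h0, hP.orthogonal_left hW _ _ (hP.degree_lt (by omega)), zero_mul]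

/-- The Christoffel-Darboux formula. -/
theorem IsMonicMOPRL.mul_kernelCD (hW : IsWeight W) (hP : IsMonicMOPRL W P)
    (hκ : IsNormalization W P κ) (n : ℕ) (z : ℂ) :
    (X - C (Matrix.scalar (Fin N) (conj z))) * kernelCD P κ n z =
      C ((mEval (prev P n) z)ᴴ * (gam κ n * bet κ n)) * P n
        - C ((mEval (P n) z)ᴴ * (gam κ n * bet κ n)) * prev P n := by
  induction n with
  | zero => simp [kernelCD, bet]
  | succ n ih =>
    -- The recurrence is used twice, adjointed at `z` here and in the variable `X` below. In the
    -- difference the `α` terms cancel since `γ α` is Hermitian, and the rest telescopes.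
    have hz : Matrix.scalar (Fin N) (conj z) * (mEval (P n) z)ᴴ =
        (mEval (P (n + 1)) z)ᴴ + (mEval (P n) z)ᴴ * (alp P n)ᴴ
          + (mEval (prev P n) z)ᴴ * (bet κ n)ᴴ := by
      rw [scalar_mul_eq_smul, ← Complex.star_def, ← Matrix.conjTranspose_smul,
        hP.smul_mEval hW hκ]
      simp only [Matrix.conjTranspose_add, Matrix.conjTranspose_mul]
    have hX : X * (C ((mEval (P n) z)ᴴ * gam κ n) * P n) =
        C ((mEval (P n) z)ᴴ * gam κ n)
          * (P (n + 1) + C (alp P n) * P n + C (bet κ n) * prev P n) := by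
      rw [← mul_assoc, X_mul_C, mul_assoc, hP.X_mul hW hκ]
    rw [kernelCD, Finset.sum_range_succ, mul_add, ← kernelCD, ih, sub_mul, hX, ← mul_assoc (C _),
      ← C_mul, ← mul_assoc (Matrix.scalar _ _), hz, gam_mul_bet_succ hW hκ, add_mul, add_mul,
      mul_assoc _ (alp P n)ᴴ, hP.alp_conjTranspose_mul_gam hW hκ, mul_assoc _ (bet κ n)ᴴ,
      gam_mul_bet_conjTranspose hW hκ, prev]
    simp only [C_mul, C_add, add_mul, mul_add, mul_assoc]
    abel

end Orthogonal

/-! ### Division by `X - z` for a scalar `z` -/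

section Division

variable {N : ℕ}

/-- The quotient of a matrix polynomial by `X - z` for a scalar `z`. -/
noncomputable def divScalar (z : ℂ) (F : (Mat N)[X]) : (Mat N)[X] :=
  F /ₘ (X - C (Matrix.scalar (Fin N) z))

theorem commute_X_sub_C_scalar (z : ℂ) (F : (Mat N)[X]) :
    Commute (X - C (Matrix.scalar (Fin N) z)) F := by
  refine (commute_X F).sub_left ?_
  ext1 m
  rw [coeff_C_mul, coeff_mul_C]
  exact (commute_scalar _ _).symm

theorem divScalar_eq {z : ℂ} {F Q : (Mat N)[X]} {A : Mat N}
    (h : F = C A + (X - C (Matrix.scalar (Fin N) z)) * Q) : divScalar z F = Q := by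
  -- For `N = 0` the coefficient ring is trivial and `X - z` does not have degree one.
  rcases subsingleton_or_nontrivial (Mat N) with _ | _
  · exact Subsingleton.elim _ _
  · refine (div_modByMonic_unique Q (C A) (monic_X_sub_C _) ⟨h.symm, ?_⟩).1
    rw [degree_X_sub_C]
    exact degree_C_lt

theorem eq_add_mul_divScalar (z : ℂ) (F : (Mat N)[X]) :
    F = C (mEval F z) + (X - C (Matrix.scalar (Fin N) z)) * divScalar z F := by
  rcases subsingleton_or_nontrivial (Mat N) with _ | _
  · exact Subsingleton.elim _ _
  · have h := modByMonic_add_div F (X - C (Matrix.scalar (Fin N) z))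
    have hdeg := degree_modByMonic_lt F (monic_X_sub_C (Matrix.scalar (Fin N) z))
    rw [degree_X_sub_C] at hdeg
    obtain ⟨A, hA⟩ : ∃ A, F %ₘ (X - C (Matrix.scalar (Fin N) z)) = C A :=
      ⟨_, eq_C_of_degree_le_zero (Nat.WithBot.lt_one_iff_le_zero.1 hdeg)⟩
    rw [hA] at h
    have hz := congrArg (mEval · z) h
    simp only [mEval_add, mEval_C, mEval_mul, mEval_sub] at hz
    rw [mEval, eval_X, sub_self, zero_mul, add_zero] at hz
    rw [← hz]
    exact h.symm

theorem C_natCast_mul (k : ℕ) (F : (Mat N)[X]) : C (k : Mat N) * F = k • F := by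
  rw [nsmul_eq_mul, C_eq_natCast]

theorem divScalar_add (z : ℂ) (F K : (Mat N)[X]) :
    divScalar z (F + K) = divScalar z F + divScalar z K := by
  refine divScalar_eq (A := mEval F z + mEval K z) ?_
  nth_rewrite 1 [eq_add_mul_divScalar z F, eq_add_mul_divScalar z K]
  rw [C_add, mul_add]
  abel

theorem divScalar_sub (z : ℂ) (F K : (Mat N)[X]) :
    divScalar z (F - K) = divScalar z F - divScalar z K := by
  rw [eq_sub_iff_add_eq, ← divScalar_add, sub_add_cancel]

theorem divScalar_C_mul (z : ℂ) (A : Mat N) (F : (Mat N)[X]) :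
    divScalar z (C A * F) = C A * divScalar z F := by
  refine divScalar_eq (A := A * mEval F z) ?_
  nth_rewrite 1 [eq_add_mul_divScalar z F]
  rw [mul_add, ← mul_assoc (C A), ← mul_assoc (_ - _), (commute_X_sub_C_scalar z (C A)).eq, C_mul]

theorem divScalar_nsmul (z : ℂ) (k : ℕ) (F : (Mat N)[X]) :
    divScalar z (k • F) = k • divScalar z F := by
  rw [← C_natCast_mul, divScalar_C_mul, C_natCast_mul]

theorem divScalar_X_sub_mul (z : ℂ) (F : (Mat N)[X]) :
    divScalar z ((X - C (Matrix.scalar (Fin N) z)) * F) = F :=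
  divScalar_eq (A := 0) (by rw [C_0, zero_add])

theorem X_sub_mul_divScalar (z : ℂ) (F : (Mat N)[X]) :
    (X - C (Matrix.scalar (Fin N) z)) * divScalar z F = F - C (mEval F z) :=
  eq_sub_of_add_eq' (eq_add_mul_divScalar z F).symm

/-- The inner product is conjugate-linear on the right, so `z` changes to `z̄` when the factor
crosses over. -/
theorem mInner_mul_right_X_sub {W : ℝ → Mat N} (hW : IsWeight W) (Q R : (Mat N)[X]) (z : ℂ) :
    mInner W Q ((X - C (Matrix.scalar (Fin N) z)) * R) =
      mInner W ((X - C (Matrix.scalar (Fin N) (conj z))) * Q) R := by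
  rw [sub_mul, sub_mul, mInner_sub_left hW, mInner_sub_right hW, mInner_X_mul_left,
    mInner_C_mul_left hW, mInner_C_mul_right hW, conjTranspose_scalar, (commute_scalar _ _).eq]

/-- Horner's scheme; the same recursion governs `Del` (see `Del_succ`). -/
theorem coeff_divScalar (z : ℂ) (F : (Mat N)[X]) (r : ℕ) :
    (divScalar z F).coeff r = F.coeff (r + 1) + z • (divScalar z F).coeff (r + 1) := by
  rw [divScalar, coeff_divByMonic_X_sub_C_rec, scalar_mul_eq_smul]

theorem coeff_divScalar_eq_zero (z : ℂ) (F : (Mat N)[X]) {r : ℕ} (h : F.natDegree ≤ r) :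
    (divScalar z F).coeff r = 0 := by
  rw [divScalar, coeff_divByMonic_X_sub_C, Finset.Icc_eq_empty (by omega), Finset.sum_empty]

end Division

/-! ### The lowering relation for a skew-symmetric operator `P ↦ ε P' + P G` -/

section Ladder

variable {N : ℕ} {W : ℝ → Mat N} {P : ℕ → (Mat N)[X]} {κ : ℕ → Mat N}

/-- The operator `P ↦ ε P' + P G`. -/
noncomputable def ladderOp (ε : ℕ) (G P : (Mat N)[X]) : (Mat N)[X] := ε • derivative P + P * G

theorem ladderOp_C_mul (ε : ℕ) (G : (Mat N)[X]) (A : Mat N) (Q : (Mat N)[X]) :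
    ladderOp ε G (C A * Q) = C A * ladderOp ε G Q := by
  rw [ladderOp, ladderOp, derivative_C_mul, mul_add, mul_smul_comm, mul_assoc]

theorem ladderOp_sub (ε : ℕ) (G Q R : (Mat N)[X]) :
    ladderOp ε G (Q - R) = ladderOp ε G Q - ladderOp ε G R := by
  rw [ladderOp, ladderOp, ladderOp, derivative_sub, smul_sub, sub_mul]
  abel

/-- The commutator with multiplication by `X - z` is only `ε`; after division by `X - z` it leaves a
term of degree too low to pair with `Pₙ₊₁`. -/
theorem ladderOp_X_sub_mul (ε : ℕ) (G Q : (Mat N)[X]) (z : ℂ) :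
    ladderOp ε G ((X - C (Matrix.scalar (Fin N) z)) * Q) =
      (X - C (Matrix.scalar (Fin N) z)) * ladderOp ε G Q + ε • Q := by
  rw [ladderOp, ladderOp, derivative_mul, derivative_X_sub_C, one_mul, smul_add, mul_add,
    mul_smul_comm, mul_assoc]
  abel

/-- The lowering relation, with its coefficients expressed by inner products. -/
theorem IsMonicMOPRL.mEval_ladderOp (hW : IsWeight W) (hP : IsMonicMOPRL W P)
    (hκ : IsNormalization W P κ) {ε : ℕ} {G : (Mat N)[X]}
    (hskew : ∀ Q R, mInner W (ladderOp ε G Q) R = -mInner W Q (ladderOp ε G R))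
    (n : ℕ) (z : ℂ) :
    mEval (ladderOp ε G (P (n + 1))) z =
      (mInner W (divScalar z (ladderOp ε G (P (n + 1)))) (P n)
        + mInner W (P (n + 1)) (divScalar (conj z) (ladderOp ε G (P n))))
          * gam κ n * mEval (P (n + 1)) z
      - (mInner W (divScalar z (ladderOp ε G (P (n + 1)))) (P (n + 1))
        + mInner W (P (n + 1)) (divScalar (conj z) (ladderOp ε G (P (n + 1)))))
          * gam κ n * mEval (P n) z := by
  set K := kernelCD P κ (n + 1) z with hK
  set F := ladderOp ε G (P (n + 1)) with hF
  set D := divScalar z F with hD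
  set A := (mEval (P (n + 1)) z)ᴴ * gam κ n with hA
  set B := (mEval (P n) z)ᴴ * gam κ n with hB
  have hCD : (X - C (Matrix.scalar (Fin N) (conj z))) * K = C B * P (n + 1) - C A * P n := by
    have := hP.mul_kernelCD hW hκ (n + 1) z
    rwa [gam_mul_bet_succ hW hκ] at this
  have hAh : Aᴴ = gam κ n * mEval (P (n + 1)) z := by
    rw [hA, Matrix.conjTranspose_mul, Matrix.conjTranspose_conjTranspose, gam_conjTranspose]
  have hBh : Bᴴ = gam κ n * mEval (P n) z := by
    rw [hB, Matrix.conjTranspose_mul, Matrix.conjTranspose_conjTranspose, gam_conjTranspose]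
  -- The factor `X - z̄` moves onto `D` as `X - z` and restores `F - F(z)`; the constant is then
  -- reproduced by `K`.
  have hleft : mInner W D (C B * P (n + 1) - C A * P n) = mInner W F K - mEval F z := by
    rw [← hCD, mInner_mul_right_X_sub hW, Complex.conj_conj, hD, X_sub_mul_divScalar,
      mInner_sub_left hW, ← mul_one (C (mEval F z)), mInner_C_mul_left hW, hK,
      hP.mInner_one_kernelCD hW hκ, mul_one]
  have hright : mInner W (P (n + 1)) (C B * divScalar (conj z) F
      - C A * divScalar (conj z) (ladderOp ε G (P n))) = -mInner W F K := by
    have hdeg : (ε • divScalar (conj z) K).degree < (n + 1 : ℕ) :=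
      (degree_smul_le _ _).trans_lt
        ((degree_divByMonic_le _ _).trans_lt (hP.degree_kernelCD_lt _ _))
    rw [← divScalar_C_mul, ← divScalar_C_mul, ← divScalar_sub, hF, ← ladderOp_C_mul,
      ← ladderOp_C_mul, ← ladderOp_sub, ← hCD, ladderOp_X_sub_mul, divScalar_add,
      divScalar_X_sub_mul, divScalar_nsmul, mInner_add_right hW, hP.orthogonal _ _ hdeg, add_zero,
      hskew, neg_neg]
  rw [mInner_sub_right hW, mInner_C_mul_right hW, mInner_C_mul_right hW, hAh, hBh] at hleft hright
  -- The sum cancels the unknown `⟨F, K⟩` and leaves `-F(z)` on the right.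
  have hsum := congrArg₂ (· + ·) hleft hright
  simp only [← mul_assoc] at hsum
  rw [eq_comm, ← sub_eq_zero, ← neg_eq_zero, ← sub_eq_zero.2 hsum]
  simp only [add_mul]
  abel

end Ladder

/-! ### The coefficients of the ladder relations -/

section Coefficients

variable {N : ℕ} {W : ℝ → Mat N} {P : ℕ → (Mat N)[X]} {κ : ℕ → Mat N}

theorem IsMonicMOPRL.bCoeff_natCast (hP : IsMonicMOPRL W P) (n r : ℕ) :
    bCoeff W P n r = mInner W (P n) (X ^ r) := by
  rw [bCoeff]
  split_ifs with h
  · exact (hP.orthogonal n _ ((degree_X_pow_le r).trans_lt (by exact_mod_cast h))).symm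
  · rw [mInner_X_pow, Int.toNat_natCast]

theorem truncP_succ (P : ℕ → (Mat N)[X]) (n k : ℕ) (z : ℂ) :
    truncP P n (k + 1) z = z • truncP P n k z + aCoeff P n ((n : ℤ) - (k + 1 : ℕ)) := by
  rw [truncP, Finset.sum_range_succ, Nat.sub_self, pow_zero, one_smul, truncP, Finset.smul_sum]
  congr 1
  refine Finset.sum_congr rfl fun l hl => ?_
  rw [smul_smul, ← pow_succ', Nat.sub_add_comm (Nat.lt_succ_iff.1 (Finset.mem_range.1 hl))]

theorem truncP_zero (P : ℕ → (Mat N)[X]) (n : ℕ) (z : ℂ) :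
    truncP P n 0 z = aCoeff P n ((n : ℤ) - (0 : ℕ)) := by
  simp [truncP]

/-- Each truncation satisfies `P_{n,k+1} = z P_{n,k} + a_{n,n-k-1}`. The bound on `j` keeps the
truncated subtraction in the index of `G.coeff` exact. -/
theorem Del_succ (P : ℕ → (Mat N)[X]) (G : (Mat N)[X]) {j : ℕ} (hj : j < G.natDegree) (n : ℕ)
    (z : ℂ) : Del P G (j + 1) n z = z • Del P G j n z
      + ∑ k ∈ Finset.range (j + 2),
        aCoeff P n ((n : ℤ) - k) * G.coeff (G.natDegree - (j + 1) + k) := by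
  have h (k : ℕ) : G.natDegree - (j + 1) + (k + 1) = G.natDegree - j + k := by omega
  rw [Del, Finset.sum_range_succ', Finset.sum_range_succ' (n := j + 1), truncP_zero, Del,
    Finset.smul_sum, ← add_assoc, ← Finset.sum_add_distrib]
  congr 1
  refine Finset.sum_congr rfl fun k _ => ?_
  rw [truncP_succ, add_mul, h, Matrix.smul_mul]

theorem coeff_mul_eq_sum_aCoeff (P : ℕ → (Mat N)[X]) (G : (Mat N)[X]) (n q : ℕ) :
    (P n * G).coeff q =
      ∑ i ∈ Finset.range (G.natDegree + 1), aCoeff P n ((q : ℤ) - i) * G.coeff i := by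
  nth_rewrite 1 [G.as_sum_range_C_mul_X_pow]
  rw [Finset.mul_sum, finsetSum_coeff]
  refine Finset.sum_congr rfl fun i _ => ?_
  rw [← mul_assoc, coeff_mul_X_pow', aCoeff]
  split_ifs with h h' h'
  · omega
  · rw [coeff_mul_C]
    congr 2
    omega
  · rw [zero_mul]
  · omega

theorem IsMonicMOPRL.aCoeff_eq_zero (hP : IsMonicMOPRL W P) {n : ℕ} {q : ℤ} (h : n < q) :
    aCoeff P n q = 0 := by
  rw [aCoeff, if_neg (by omega), hP.coeff_eq_zero (by omega)]

theorem IsMonicMOPRL.coeff_mul_eq_sum (hP : IsMonicMOPRL W P) (G : (Mat N)[X]) {n j q : ℕ}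
    (hj : j ≤ G.natDegree) (hq : q + j = n + G.natDegree) :
    (P n * G).coeff q = ∑ k ∈ Finset.range (j + 1),
      aCoeff P n ((n : ℤ) - k) * G.coeff (G.natDegree - j + k) := by
  rw [coeff_mul_eq_sum_aCoeff, show G.natDegree + 1 = (G.natDegree - j) + (j + 1) by omega,
    Finset.sum_range_add, Finset.sum_eq_zero, zero_add]
  · refine Finset.sum_congr rfl fun k _ => ?_
    congr 2
    omega
  · intro i hi
    have := Finset.mem_range.1 hi
    rw [hP.aCoeff_eq_zero (by omega), zero_mul]

/-- The derivative has degree below `n`, which is why `Δ_{j,n}` does not depend on `ε`. -/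
theorem IsMonicMOPRL.coeff_ladderOp (hP : IsMonicMOPRL W P) (ε : ℕ) (G : (Mat N)[X]) {n q : ℕ}
    (hq : n ≤ q) : (ladderOp ε G (P n)).coeff q = (P n * G).coeff q := by
  rw [ladderOp, coeff_add, coeff_smul, coeff_derivative, hP.coeff_eq_zero (by omega), zero_mul,
    smul_zero, zero_add]

theorem IsMonicMOPRL.natDegree_ladderOp_le (hP : IsMonicMOPRL W P) (ε : ℕ) (G : (Mat N)[X])
    (n : ℕ) : (ladderOp ε G (P n)).natDegree ≤ n + G.natDegree := by
  rw [natDegree_le_iff_coeff_eq_zero]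
  intro q hq
  rw [hP.coeff_ladderOp ε G (by omega)]
  exact coeff_eq_zero_of_natDegree_lt
    (natDegree_mul_le.trans_lt (by have := hP.natDegree_le n; omega))

/-- Both sides obey the same Horner recursion, descending from the top coefficient. The bound on `j`
keeps `r + 1 ≥ n`, where the derivative does not contribute. -/
theorem IsMonicMOPRL.Del_eq_coeff (hP : IsMonicMOPRL W P) (ε : ℕ) (G : (Mat N)[X]) (n : ℕ)
    (z : ℂ) {j : ℕ} (hj : j ≤ G.natDegree) {r : ℕ} (hr : r + 1 + j = n + G.natDegree) :
    Del P G j n z = (divScalar z (ladderOp ε G (P n))).coeff r := by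
  rw [coeff_divScalar, hP.coeff_ladderOp ε G (by omega), hP.coeff_mul_eq_sum G hj hr]
  induction j generalizing r with
  | zero =>
    rw [coeff_divScalar_eq_zero _ _ (by have := hP.natDegree_ladderOp_le ε G n; omega), smul_zero,
      add_zero, Del]
    simp only [zero_add, Finset.sum_range_one, truncP_zero]
  | succ j ih =>
    rw [Del_succ P G hj, ih (by omega) (r := r + 1) (by omega), coeff_divScalar z _ (r + 1),
      hP.coeff_ladderOp ε G (by omega), hP.coeff_mul_eq_sum G (j := j) (by omega) (by omega),
      add_comm]

theorem mInner_eq_sum_coeff (hW : IsWeight W) (R Q : (Mat N)[X]) {M : ℕ}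
    (hQ : ∀ r, M ≤ r → Q.coeff r = 0) :
    mInner W R Q = ∑ r ∈ Finset.range M, mInner W R (X ^ r) * (Q.coeff r)ᴴ := by
  have h : Q = ∑ r ∈ Finset.range M, C (Q.coeff r) * X ^ r := by
    ext1 k
    simp only [finsetSum_coeff, coeff_C_mul_X_pow]
    rw [Finset.sum_ite_eq]
    split_ifs with hk
    · rfl
    · exact hQ k (not_lt.1 (Finset.mem_range.not.1 hk))
  nth_rewrite 1 [h]
  simp only [mInner_sum_right hW, mInner_C_mul_right hW]

/-- Expand the quotient in powers of `X` on the right of the inner product. By `hk`, every index `j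
≥ m` gives a moment of order below `n`, which is zero, so the sum may stop at `m`. The `𝒜` sums use
`m = deg G`, the `ℬ` sums `m = deg G + 1`. -/
theorem IsMonicMOPRL.sum_bCoeff_mul_Del (hW : IsWeight W) (hP : IsMonicMOPRL W P) (ε : ℕ)
    (G : (Mat N)[X]) (n k : ℕ) (z : ℂ) {m : ℕ} (hm : m ≤ G.natDegree + 1)
    (hk : k + G.natDegree ≤ n + m) :
    ∑ j ∈ Finset.range m, bCoeff W P n ((k : ℤ) + G.natDegree - j - 1) * (Del P G j k z)ᴴ =
      mInner W (P n) (divScalar z (ladderOp ε G (P k))) := by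
  set Q := divScalar z (ladderOp ε G (P k)) with hQ
  set ψ : ℕ → Mat N := fun j => bCoeff W P n ((k : ℤ) + G.natDegree - j - 1)
    * (Q.coeff (k + G.natDegree - 1 - j))ᴴ with hψ
  have hbig : ∀ j, k + G.natDegree ≤ j → ψ j = 0 := fun j hj => by
    simp only [hψ]
    rw [bCoeff, if_pos (by omega), zero_mul]
  have hlow : ∀ j, m ≤ j → ψ j = 0 := fun j hj => by
    simp only [hψ]
    rw [bCoeff, if_pos (by omega), zero_mul]
  calc ∑ j ∈ Finset.range m, bCoeff W P n ((k : ℤ) + G.natDegree - j - 1) * (Del P G j k z)ᴴ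
      = ∑ j ∈ Finset.range m, ψ j := by
        refine Finset.sum_congr rfl fun j hj => ?_
        have hj := Finset.mem_range.1 hj
        by_cases h : k + G.natDegree ≤ j
        -- Here the exponent `k + deg G - j - 1` is negative, so the convention for `bCoeff` makes
        -- the term zero; this occurs for `k = 0`, `j = deg G`.
        · rw [hbig j h, bCoeff, if_pos (by omega), zero_mul]
        · simp only [hψ]
          rw [hP.Del_eq_coeff ε G k z (j := j) (r := k + G.natDegree - 1 - j) (by omega)
            (by omega)]
    _ = ∑ j ∈ Finset.range (max m (k + G.natDegree)), ψ j :=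
        Finset.sum_subset (Finset.range_mono (le_max_left _ _)) fun j _ hj =>
          hlow j (not_lt.1 (Finset.mem_range.not.1 hj))
    _ = ∑ j ∈ Finset.range (k + G.natDegree), ψ j :=
        (Finset.sum_subset (Finset.range_mono (le_max_right _ _)) fun j _ hj =>
          hbig j (not_lt.1 (Finset.mem_range.not.1 hj))).symm
    _ = ∑ j ∈ Finset.range (k + G.natDegree),
          (fun r => mInner W (P n) (X ^ r) * (Q.coeff r)ᴴ) (k + G.natDegree - 1 - j) := by
        refine Finset.sum_congr rfl fun j hj => ?_
        have hj := Finset.mem_range.1 hj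
        simp only [hψ]
        rw [← hP.bCoeff_natCast]
        congr 2
        omega
    _ = mInner W (P n) Q := by
        rw [Finset.sum_range_reflect (fun r => mInner W (P n) (X ^ r) * (Q.coeff r)ᴴ),
          ← mInner_eq_sum_coeff hW]
        exact fun r hr =>
          coeff_divScalar_eq_zero _ _ ((hP.natDegree_ladderOp_le ε G k).trans hr)

theorem IsMonicMOPRL.sum_Del_mul_bCoeff (hW : IsWeight W) (hP : IsMonicMOPRL W P) (ε : ℕ)
    (G : (Mat N)[X]) (n k : ℕ) (z : ℂ) {m : ℕ} (hm : m ≤ G.natDegree + 1)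
    (hk : k + G.natDegree ≤ n + m) :
    ∑ j ∈ Finset.range m, Del P G j k z * (bCoeff W P n ((k : ℤ) + G.natDegree - j - 1))ᴴ =
      mInner W (divScalar z (ladderOp ε G (P k))) (P n) := by
  rw [← mInner_conjTranspose hW, ← hP.sum_bCoeff_mul_Del hW ε G n k z hm hk,
    Matrix.conjTranspose_sum]
  simp only [Matrix.conjTranspose_mul, Matrix.conjTranspose_conjTranspose]

theorem IsMonicMOPRL.mStar_ladderA (hW : IsWeight W) (hP : IsMonicMOPRL W P) (ε : ℕ)
    (G : (Mat N)[X]) (n : ℕ) (z : ℂ) :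
    mStar (ladderA W P κ G n) z =
      -((mInner W (divScalar z (ladderOp ε G (P n))) (P n)
        + mInner W (P n) (divScalar (conj z) (ladderOp ε G (P n)))) * gam κ n) := by
  simp only [mStar, ladderA, Complex.conj_conj]
  rw [Finset.sum_add_distrib, hP.sum_bCoeff_mul_Del hW ε G n n z (Nat.le_succ _) le_rfl,
    hP.sum_Del_mul_bCoeff hW ε G n n (conj z) (Nat.le_succ _) le_rfl, Matrix.conjTranspose_neg,
    Matrix.conjTranspose_mul, gam_conjTranspose, Matrix.conjTranspose_add,
    mInner_conjTranspose hW, mInner_conjTranspose hW]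

theorem IsMonicMOPRL.ladderB_succ (hW : IsWeight W) (hP : IsMonicMOPRL W P) (ε : ℕ)
    (G : (Mat N)[X]) (n : ℕ) (z : ℂ) :
    ladderB W P κ G (n + 1) z =
      -((mInner W (divScalar z (ladderOp ε G (P (n + 1)))) (P n)
        + mInner W (P (n + 1)) (divScalar (conj z) (ladderOp ε G (P n)))) * gam κ n) := by
  have h (j : ℕ) : ((n + 1 : ℕ) : ℤ) + G.natDegree - j - 2 = (n : ℤ) + G.natDegree - j - 1 := by
    push_cast
    ring
  simp only [ladderB, mStar, h]
  rw [Finset.sum_add_distrib, hP.sum_bCoeff_mul_Del hW ε G (n + 1) n (conj z) le_rfl (by omega),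
    hP.sum_Del_mul_bCoeff hW ε G n (n + 1) z le_rfl (by omega)]

/-- The lowering relation of a skew-symmetric operator `P ↦ ε P' + P G`. -/
theorem IsMonicMOPRL.lowering (hW : IsWeight W) (hP : IsMonicMOPRL W P)
    (hκ : IsNormalization W P κ) {ε : ℕ} {G : (Mat N)[X]}
    (hskew : ∀ Q R, mInner W (ladderOp ε G Q) R = -mInner W Q (ladderOp ε G R))
    (n : ℕ) (z : ℂ) :
    mEval (ladderOp ε G (P n)) z = -ladderB W P κ G n z * mEval (P n) z
      + mStar (ladderA W P κ G n) z * bet κ n * mEval (prev P n) z := by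
  cases n with
  | zero =>
    have h0 : P 0 = 1 := by
      rw [eq_C_of_natDegree_le_zero (hP.natDegree_le 0), hP.coeff_self, C_1]
    rw [h0, ladderOp, derivative_one, smul_zero, zero_add, one_mul, mEval_one, ladderB, bet,
      neg_neg, mul_one, mul_zero, zero_mul, add_zero]
  | succ n =>
    -- The lowering formula carries `γₙ` next to `Pₙ`, while `𝒜ₙ₊₁*` ends in `γₙ₊₁`; the factor
    -- `βₙ₊₁` converts one into the other.
    rw [hP.mEval_ladderOp hW hκ hskew, hP.mStar_ladderA hW ε, hP.ladderB_succ hW ε, prev, neg_neg,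
      neg_mul, mul_assoc _ (gam κ (n + 1)), gam_mul_bet_succ hW hκ, neg_mul, ← sub_eq_add_neg]

/-- The raising relation follows from the lowering one by the three-term recurrence. -/
theorem IsMonicMOPRL.raising_of_lowering (hW : IsWeight W) (hP : IsMonicMOPRL W P)
    (hκ : IsNormalization W P κ) {n : ℕ} {z : ℂ} {F A B : Mat N}
    (h : F = -B * mEval (P n) z + A * bet κ n * mEval (prev P n) z) :
    F = (A * (Matrix.scalar (Fin N) z - alp P n) - B) * mEval (P n) z
      - A * mEval (P (n + 1)) z := by
  have hrec := hP.smul_mEval hW hκ n z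
  have hβ : bet κ n * mEval (prev P n) z =
      Matrix.scalar (Fin N) z * mEval (P n) z - alp P n * mEval (P n) z - mEval (P (n + 1)) z := by
    rw [scalar_mul_eq_smul, hrec]
    abel
  rw [h, mul_assoc, hβ]
  noncomm_ring

end Coefficients

end MOPRL

/-! ### The ladder relations for `G` and `H`, and the elimination of `βₙ Pₙ₋₁`. -/

theorem mainTheorem3 (N : ℕ) (W : ℝ → Mat N) (hW : IsWeight W)
    (P : ℕ → (Mat N)[X]) (hP : IsMonicMOPRL W P)
    (κ : ℕ → Mat N) (hκ : IsNormalization W P κ)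
    (T : ℂ → Mat N) (G : (Mat N)[X]) (hT : IsFactorization W T G)
    (S : ℂ → Mat N) (H : (Mat N)[X]) (hS : IsUnitaryChange T S H) (n : ℕ) :
    -- the matrices `αₙ`, `βₙ` are the coefficients of the three-term recurrence relation
    (∀ z : ℂ, z • mEval (P n) z =
      mEval (P (n + 1)) z + alp P n * mEval (P n) z + bet κ n * mEval (prev P n) z) ∧
    -- first order lowering and raising relations for `G`
    (∀ z : ℂ, mEval (derivative (P n)) z + mEval (P n) z * mEval G z =
      -ladderB W P κ G n z * mEval (P n) z
        + mStar (ladderA W P κ G n) z * bet κ n * mEval (prev P n) z) ∧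
    (∀ z : ℂ, mEval (derivative (P n)) z + mEval (P n) z * mEval G z =
      (mStar (ladderA W P κ G n) z * (Matrix.scalar (Fin N) z - alp P n) - ladderB W P κ G n z)
          * mEval (P n) z
        - mStar (ladderA W P κ G n) z * mEval (P (n + 1)) z) ∧
    -- lowering and raising relations of order zero for `H`
    (∀ z : ℂ, mEval (P n) z * mEval H z =
      -ladderB W P κ H n z * mEval (P n) z
        + mStar (ladderA W P κ H n) z * bet κ n * mEval (prev P n) z) ∧
    (∀ z : ℂ, mEval (P n) z * mEval H z =
      (mStar (ladderA W P κ H n) z * (Matrix.scalar (Fin N) z - alp P n) - ladderB W P κ H n z)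
          * mEval (P n) z
        - mStar (ladderA W P κ H n) z * mEval (P (n + 1)) z) ∧
    -- the first order differential relation
    ((∀ z : ℂ, IsUnit (ladderA W P κ G n z)) →
      ∀ z : ℂ, mEval (P n) z * mEval H z + ladderB W P κ H n z * mEval (P n) z
        - mStar (ladderA W P κ H n) z * mStar (fun w => (ladderA W P κ G n w)⁻¹) z
          * (mEval (derivative (P n)) z + mEval (P n) z * mEval G z
            + ladderB W P κ G n z * mEval (P n) z) = 0) := by
  have hlowG (z : ℂ) : mEval (derivative (P n)) z + mEval (P n) z * mEval G z =
      -ladderB W P κ G n z * mEval (P n) z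
        + mStar (ladderA W P κ G n) z * bet κ n * mEval (prev P n) z := by
    have hskew : ∀ Q R, mInner W (ladderOp 1 G Q) R = -mInner W Q (ladderOp 1 G R) :=
      fun Q R => by simpa only [ladderOp, one_smul] using hT.mInner_skew hW Q R
    rw [← hP.lowering hW hκ hskew n z, ladderOp, one_smul, mEval_add, mEval_mul]
  have hlowH (z : ℂ) : mEval (P n) z * mEval H z =
      -ladderB W P κ H n z * mEval (P n) z
        + mStar (ladderA W P κ H n) z * bet κ n * mEval (prev P n) z := by
    have hskew : ∀ Q R, mInner W (ladderOp 0 H Q) R = -mInner W Q (ladderOp 0 H R) :=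
      fun Q R => by simpa only [ladderOp, zero_smul, zero_add] using hS.mInner_skew hW hT Q R
    rw [← hP.lowering hW hκ hskew n z, ladderOp, zero_smul, zero_add, mEval_mul]
  refine ⟨hP.smul_mEval hW hκ n, hlowG, fun z => hP.raising_of_lowering hW hκ (hlowG z), hlowH,
    fun z => hP.raising_of_lowering hW hκ (hlowH z), fun hA z => ?_⟩
  have hinv : mStar (fun w => (ladderA W P κ G n w)⁻¹) z * mStar (ladderA W P κ G n) z = 1 := by
    rw [mStar, mStar, ← Matrix.conjTranspose_mul,
      Matrix.mul_nonsing_inv _ ((Matrix.isUnit_iff_isUnit_det _).1 (hA _)),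
      Matrix.conjTranspose_one]
  -- The lowering relation for `G` isolates `𝒜ₙ*(z; G) βₙ Pₙ₋₁`; inverting `𝒜ₙ*` leaves the `βₙ
  -- Pₙ₋₁` that enters the relation for `H`.
  have hG : mEval (derivative (P n)) z + mEval (P n) z * mEval G z
      + ladderB W P κ G n z * mEval (P n) z =
      mStar (ladderA W P κ G n) z * (bet κ n * mEval (prev P n) z) := by
    rw [hlowG, ← mul_assoc]
    noncomm_ring
  rw [hG, ← mul_assoc, mul_assoc (mStar _ z) (mStar _ z) (mStar _ z), hinv, mul_one, hlowH]
  noncomm_ring
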